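/- Let $\zeta$ be the Thue--Morse substitution $\zeta(0)=01$, $\zeta(1)=10$, let $u_0u_1u_2\cdots=0110100110010110\cdots$ be the unique infinite word beginning with $0$ that is fixed by $v_0v_1v_2\cdots\mapsto\zeta(v_0)\zeta(v_1)\zeta(v_2)\cdots$, and let $u\in\{0,1\}^{\mathbb Z}$ be the bilateral word $\cdots u_2u_1u_0\,.\,u_0u_1u_2\cdots$ (with letter $u_n$ at the positions $n$ and $-1-n$ for every $n\ge 0$). The Thue--Morse subshift is $(X_\zeta,\sigma)$, where $\sigma$ is the shift $(\sigma x)_n=x_{n+1}$ on $\{0,1\}^{\mathbb Z}$ with the product topology and $X_\zeta=\overline{\{\sigma^k u:k\in\mathbb Z\}}$. For a homeomorphism $T$ of a compact metrizable space $X$, let $C(X)$ be the Banach space of real continuous functions on $X$ with the supremum norm, and let the topological multiplicity $\mathrm{Mult}(T)\in\mathbb N\cup\{\infty\}$ be the smallest cardinality of a set $F\subset C(X)$ such that the linear span of $\{f\circ T^k: f\in F,\ k\in\mathbb Z\}$ is dense in $C(X)$. The system $(X,T)$ is called topologically simple if $\mathrm{Mult}(T)=1$. Theorem. The Thue--Morse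 subshift is topologically simple: $\mathrm{Mult}(\sigma|_{X_\zeta})=1$. That is, there is a single function $f\in C(X_\zeta)$ such that the linear span of $\{f\circ\sigma^k:k\in\mathbb Z\}$ is dense in $C(X_\zeta)$. -/

import Mathlib

namespace TopMult

/-! ### Multiplicity of an invertible bounded operator -/

section Operator

variable {E : Type*} [NormedAddCommGroup E] [NormedSpace ℝ E]

/-- The linear span of all `U ^ k x` with `k ∈ ℤ` and `x ∈ F`. -/
def cyclicSpan (U : E ≃L[ℝ] E) (F : Set E) : Submodule ℝ E :=
  Submodule.span ℝ {y : E | ∃ k : ℤ, ∃ x ∈ F, y = (U ^ k) x}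

/-- `F` is a generating family of `U`: the vectors `U ^ k x` (`k ∈ ℤ`, `x ∈ F`) span a dense
subspace of `E`. -/
def IsGenerating (U : E ≃L[ℝ] E) (F : Set E) : Prop :=
  Dense (cyclicSpan U F : Set E)

/-- The multiplicity of `U`: the smallest cardinality, in `ℕ ∪ {∞}`, of a generating family.
It is `0` when `E = {0}`, since the empty family is then generating. -/
noncomputable def operatorMultiplicity (U : E ≃L[ℝ] E) : ℕ∞ :=
  ⨅ F ∈ {F : Set E | IsGenerating U F}, F.encard

end Operator

/-! ### Topological multiplicity of a homeomorphism -/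

section Koopman

variable {X : Type*} [TopologicalSpace X] [CompactSpace X]

/-- The composition operator `φ ↦ φ ∘ T` on the Banach space `C(X, ℝ)` with the sup norm. -/
def compOp (T : X ≃ₜ X) : C(X, ℝ) ≃L[ℝ] C(X, ℝ) where
  toFun φ := φ.comp (T : C(X, X))
  invFun φ := φ.comp (T.symm : C(X, X))
  map_add' _ _ := rfl
  map_smul' _ _ := rfl
  left_inv φ := by ext x; simp
  right_inv φ := by ext x; simp
  continuous_toFun := ContinuousMap.continuous_precomp _
  continuous_invFun := ContinuousMap.continuous_precomp _

/-- The topological multiplicity of the system `(X, T)`. -/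
noncomputable def topologicalMultiplicity (T : X ≃ₜ X) : ℕ∞ :=
  operatorMultiplicity (compOp T)

/-- `(X, T)` is topologically simple (has simple topological spectrum). -/
def IsTopologicallySimple (T : X ≃ₜ X) : Prop :=
  topologicalMultiplicity T = 1

end Koopman

/-! ### Bilateral subshifts -/

section Subshift

variable {A : Type*} [TopologicalSpace A]

/-- The shift `(σ x) n = x (n + 1)` on the full shift `A ^ ℤ` (product topology). -/
def shift (A : Type*) [TopologicalSpace A] : (ℤ → A) ≃ₜ (ℤ → A) where
  toFun x := fun n => x (n + 1)
  invFun x := fun n => x (n - 1)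
  left_inv x := by funext n; simp
  right_inv x := by funext n; simp
  continuous_toFun := by fun_prop
  continuous_invFun := by fun_prop

/-- The closure of the orbit `{σ ^ k u : k ∈ ℤ}`, where `(σ ^ k u) n = u (n + k)`. -/
def orbitClosure (u : ℤ → A) : Set (ℤ → A) :=
  closure (Set.range fun (k : ℤ) (n : ℤ) => u (n + k))

theorem orbitClosure_eq_preimage (u : ℤ → A) :
    orbitClosure u = shift A ⁻¹' orbitClosure u := by
  unfold orbitClosure
  rw [(shift A).preimage_closure]
  congr 1
  ext x
  constructor
  · rintro ⟨k, rfl⟩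
    refine ⟨k + 1, ?_⟩
    funext n
    simp only [shift, Homeomorph.homeomorph_mk_coe, Equiv.coe_fn_mk]
    congr 1
    ring
  · rintro ⟨k, hk⟩
    refine ⟨k - 1, ?_⟩
    funext n
    have := congrFun hk (n - 1)
    simp only [shift, Homeomorph.homeomorph_mk_coe, Equiv.coe_fn_mk, sub_add_cancel] at this
    rw [← this]
    exact congrArg u (by ring)

/-- The subshift generated by `u`: the shift restricted to the orbit closure of `u`. -/
def subshift (u : ℤ → A) : orbitClosure u ≃ₜ orbitClosure u :=
  (shift A).sets (orbitClosure_eq_preimage u)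

instance compactSpace_orbitClosure [CompactSpace A] (u : ℤ → A) :
    CompactSpace (orbitClosure u) :=
  isCompact_iff_compactSpace.mp isClosed_closure.isCompact

end Subshift

/-! ### The Thue–Morse subshift -/

/-- The Thue–Morse substitution `0 ↦ 01`, `1 ↦ 10`; `zeta a` is the two-letter word
`zeta a 0, zeta a 1`. -/
def zeta (a : Fin 2) : Fin 2 → Fin 2 :=
  if a = 0 then ![0, 1] else ![1, 0]

/-- The action `v₀ v₁ v₂ … ↦ ζ(v₀) ζ(v₁) ζ(v₂) …` of the substitution on one-sided infinite
words. -/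
def zetaWord (v : ℕ → Fin 2) : ℕ → Fin 2 :=
  fun n => zeta (v (n / 2)) (Fin.ofNat 2 n)

/-- The one-sided Thue–Morse word `0110100110010110…`. -/
def thueMorse : ℕ → Fin 2
  | 0 => 0
  | n + 1 => zeta (thueMorse ((n + 1) / 2)) (Fin.ofNat 2 (n + 1))
decreasing_by omega

/-- The Thue–Morse word is a fixed point of the substitution. -/
theorem zetaWord_thueMorse : zetaWord thueMorse = thueMorse := by
  funext n
  cases n with
  | zero => simp [zetaWord, thueMorse, zeta]
  | succ n => rw [thueMorse]; rfl

/-- It is the only fixed point of the substitution that begins with the letter `0`. -/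
theorem eq_thueMorse {v : ℕ → Fin 2} (h : zetaWord v = v) (h0 : v 0 = 0) : v = thueMorse := by
  funext n
  induction n using Nat.strong_induction_on with
  | _ n ih =>
    cases n with
    | zero => rw [h0, thueMorse]
    | succ n => rw [thueMorse, ← ih ((n + 1) / 2) (by omega)]; exact (congrFun h (n + 1)).symm

/-- The bilateral word `⋯ u₂ u₁ u₀ . u₀ u₁ u₂ ⋯`, where `u₀ u₁ u₂ ⋯` is the Thue–Morse word:
the letter at `n ≥ 0` is `uₙ` and the letter at `-1 - n` is `uₙ`. -/
def biThueMorse : ℤ → Fin 2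
  | Int.ofNat n => thueMorse n
  | Int.negSucc n => thueMorse n

end TopMult

/-! Along the dense orbit of `biThueMorse` a continuous function becomes a sequence on ℤ, and the
cyclic span of `f` becomes a translation-invariant space `A` closed under uniform limits. The chosen
`f` becomes `tau + gee`: `tau` is the ±1 Thue–Morse sequence and `gee` the product of neighbouring
signs, a Toeplitz sequence read off the 4-adic odometer. The point is that `A` contains both
summands separately.

Two facts separate them. For every step `4 ^ n`, `tau` is a second difference of a sequence bounded
by 1, so its sums along that step, and even its double Fejér sums, stay bounded (`abs_sum_tau_le`,
`abs_fejer_sum_tau_le`). And `gee` is `4 ^ m`-periodic off the multiples of `4 ^ m`, on which it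
reproduces itself. Averaging along `4 ^ m` therefore leaves only a periodic part of `gee`; these
parts yield the indicators of all lattices `4 ^ m ℤ` (`inflate_one_mem`), hence `gee` up to a copy
of itself on a sparse lattice. No single averaging removes that copy. `gee_mem` averages Fejér sums
over many scales: diagonal terms reproduce `gee`, `tau` contributes little, and few off-diagonal
terms meet the lattice.

Finally `tau` yields its own inflations (`inflate_tau_mem`). On a residue class modulo `4 ^ r`, a
function of a window of length `r` depends on two neighbouring signs only, so it is a combination of
inflated translates of `1`, `tau` and `gee` (`mem_of_window`). Such sequences approximate all
continuous functions. -/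

namespace TopMult

/-! ### Closed shift-invariant spaces of sequences -/

/-- `A` is invariant under translations and closed under uniform limits. -/
structure IsClosedInvariant (A : Submodule ℝ (ℤ → ℝ)) : Prop where
  shift : ∀ w ∈ A, ∀ c : ℤ, (fun k => w (k + c)) ∈ A
  lim : ∀ s : ℤ → ℝ, (∀ ε > 0, ∃ t ∈ A, ∀ k, |t k - s k| ≤ ε) → s ∈ A

/-- The sequence supported on the multiples of `c` with value `w j` at `c * j`. -/
def inflate (c : ℕ) : (ℤ → ℝ) →ₗ[ℝ] (ℤ → ℝ) where
  toFun w := fun k => if (c : ℤ) ∣ k then w (k / c) else 0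
  map_add' v w := by
    funext k
    by_cases h : (c : ℤ) ∣ k <;> simp [h]
  map_smul' a w := by
    funext k
    by_cases h : (c : ℤ) ∣ k <;> simp [h]

theorem inflate_apply (c : ℕ) (w : ℤ → ℝ) (k : ℤ) :
    inflate c w k = if (c : ℤ) ∣ k then w (k / c) else 0 := rfl

theorem inflate_mul_self {c : ℕ} (hc : 0 < c) (w : ℤ → ℝ) (j : ℤ) :
    inflate c w (c * j) = w j := by
  have : (c : ℤ) ≠ 0 := by exact_mod_cast hc.ne'
  rw [inflate_apply, if_pos (Dvd.intro _ rfl), Int.mul_ediv_cancel_left _ this]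

theorem inflate_of_not_dvd {c : ℕ} (w : ℤ → ℝ) {k : ℤ} (h : ¬ (c : ℤ) ∣ k) :
    inflate c w k = 0 := by
  simp [inflate_apply, h]

theorem inflate_one (w : ℤ → ℝ) : inflate 1 w = w := by
  funext k
  simp [inflate_apply]

theorem inflate_inflate {c d : ℕ} (hc : 0 < c) (hd : 0 < d) (w : ℤ → ℝ) :
    inflate c (inflate d w) = inflate (c * d) w := by
  funext k
  by_cases h : (c : ℤ) ∣ k
  · obtain ⟨j, rfl⟩ := h
    rw [inflate_mul_self hc]
    by_cases h' : (d : ℤ) ∣ j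
    · obtain ⟨i, rfl⟩ := h'
      rw [inflate_mul_self hd, ← mul_assoc, ← Nat.cast_mul,
        inflate_mul_self (Nat.mul_pos hc hd)]
    · rw [inflate_of_not_dvd _ h', inflate_of_not_dvd]
      have : (c : ℤ) ≠ 0 := by exact_mod_cast hc.ne'
      rwa [Nat.cast_mul, mul_dvd_mul_iff_left this]
  · rw [inflate_of_not_dvd _ h, inflate_of_not_dvd]
    exact fun h' => h ((Dvd.intro _ (by push_cast; rfl)).trans h')

theorem inflate_shift {c : ℕ} (hc : 0 < c) (w : ℤ → ℝ) (a : ℤ) :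
    inflate c (fun k => w (k + a)) = fun k => inflate c w (k + c * a) := by
  funext k
  by_cases h : (c : ℤ) ∣ k
  · obtain ⟨j, rfl⟩ := h
    rw [← mul_add, inflate_mul_self hc, inflate_mul_self hc]
  · rw [inflate_of_not_dvd _ h, inflate_of_not_dvd]
    rwa [dvd_add_left (Dvd.intro _ rfl)]

theorem abs_inflate_sub_le {c : ℕ} {v w : ℤ → ℝ} {ε : ℝ} (hε : 0 ≤ ε)
    (h : ∀ k, |v k - w k| ≤ ε) (k : ℤ) : |inflate c v k - inflate c w k| ≤ ε := by
  by_cases hk : (c : ℤ) ∣ k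
  · simpa [inflate_apply, hk] using h _
  · simpa [inflate_apply, hk] using hε

/-- A sequence is the superposition of its restrictions to the residue classes modulo `c`. -/
theorem eq_sum_inflate {c : ℕ} (hc : 0 < c) (s : ℤ → ℝ) :
    s = ∑ i ∈ Finset.range c, fun k => inflate c (fun j => s (c * j + i)) (k + -(i : ℤ)) := by
  have hc' : (0 : ℤ) < c := by exact_mod_cast hc
  funext k
  obtain ⟨i₀, hi₀⟩ := Int.eq_ofNat_of_zero_le (Int.emod_nonneg k hc'.ne')
  have hlt : i₀ < c := by
    have := Int.emod_lt_of_pos k hc'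
    omega
  have hk : k = c * (k / c) + i₀ := by
    have := Int.mul_ediv_add_emod k c
    rw [hi₀] at this
    exact this.symm
  rw [Finset.sum_apply, Finset.sum_eq_single i₀]
  · have : k + -(i₀ : ℤ) = c * (k / c) := by linarith
    rw [this, inflate_mul_self hc, ← hk]
  · intro i hi hne
    apply inflate_of_not_dvd
    intro hd
    apply hne
    have h1 : (c : ℤ) ∣ (i₀ : ℤ) - i := by
      have : (i₀ : ℤ) - i = (k + -(i : ℤ)) - c * (k / c) := by linarith
      rw [this]
      exact dvd_sub hd (Dvd.intro _ rfl)
    have h2 := Int.eq_zero_of_abs_lt_dvd h1 (by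
      have := Finset.mem_range.mp hi
      rw [abs_lt]
      constructor <;> omega)
    omega
  · intro h
    exact absurd (Finset.mem_range.mpr hlt) h

theorem sum_range_step (c : ℤ) (V w : ℤ → ℝ) (h : ∀ k, V (k + c) - V k = w k) (k : ℤ) (N : ℕ) :
    ∑ j ∈ Finset.range N, w (k + c * j) = V (k + c * N) - V k := by
  have := Finset.sum_range_sub (fun j : ℕ => V (k + c * j)) N
  simp only [Nat.cast_zero, mul_zero, add_zero] at this
  rw [← this]
  refine Finset.sum_congr rfl fun j _ => ?_
  rw [← h]
  congr 2
  push_cast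
  ring

namespace IsClosedInvariant

variable {A : Submodule ℝ (ℤ → ℝ)}

/-- This makes self-similarity usable: a membership lemma proved at scale 1 applies verbatim at
scale `c`. -/
theorem comap_inflate (hA : IsClosedInvariant A) {c : ℕ} (hc : 0 < c) :
    IsClosedInvariant (A.comap (inflate c)) where
  shift w hw a := by
    rw [Submodule.mem_comap, inflate_shift hc]
    exact hA.shift _ hw _
  lim s hs := by
    refine hA.lim _ fun ε hε => ?_
    obtain ⟨t, ht, h⟩ := hs ε hε
    exact ⟨_, ht, abs_inflate_sub_le hε.le h⟩

/-- A periodic component can be extracted from a sequence by averaging. -/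
theorem mem_of_average (hA : IsClosedInvariant A) {h w : ℤ → ℝ} (c : ℤ) (hv : h + w ∈ A)
    (hper : ∀ k, h (k + c) = h k)
    (hw : ∀ ε > 0, ∃ N : ℕ, 0 < N ∧ ∀ k, |∑ j ∈ Finset.range N, w (k + c * j)| ≤ ε * N) :
    h ∈ A := by
  refine hA.lim _ fun ε hε => ?_
  obtain ⟨N, hN, hb⟩ := hw ε hε
  have hN' : (0 : ℝ) < N := by exact_mod_cast hN
  refine ⟨(N : ℝ)⁻¹ • ∑ j ∈ Finset.range N, fun k => (h + w) (k + c * j),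
    A.smul_mem _ (A.sum_mem fun j _ => hA.shift _ hv _), fun k => ?_⟩
  have hper' : ∀ j : ℕ, h (k + c * j) = h k := by
    intro j
    induction j with
    | zero => simp
    | succ j ih => rw [← ih, ← hper (k + c * j)]; congr 1; push_cast; ring
  have : ((N : ℝ)⁻¹ • ∑ j ∈ Finset.range N, fun k => (h + w) (k + c * j)) k - h k
      = (N : ℝ)⁻¹ * ∑ j ∈ Finset.range N, w (k + c * j) := by
    simp only [Pi.smul_apply, Finset.sum_apply, Pi.add_apply, hper', Finset.sum_add_distrib,
      Finset.sum_const, Finset.card_range, smul_eq_mul, nsmul_eq_mul]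
    field_simp
    ring
  rw [this, abs_mul, abs_of_pos (inv_pos.mpr hN'), inv_mul_le_iff₀ hN', mul_comm]
  exact hb k

/-- If `w` has bounded sums along the step `c`, it can be recovered from `w - w (· + c)`. -/
theorem mem_of_sub_shift_mem (hA : IsClosedInvariant A) {w V : ℤ → ℝ} {C : ℝ} (c : ℤ)
    (hV : ∀ k, |V k| ≤ C) (hVw : ∀ k, V (k + c) - V k = w k)
    (hw : (fun k => w k - w (k + c)) ∈ A) : w ∈ A := by
  have hC : 0 ≤ C := (abs_nonneg _).trans (hV 0)
  have htel : ∀ j : ℕ, (fun k => w k - w (k + c * j)) ∈ A := by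
    intro j
    induction j with
    | zero =>
      convert A.zero_mem using 1
      funext k
      simp
    | succ j ih =>
      convert A.add_mem ih (hA.shift _ hw (c * j)) using 1
      funext k
      simp only [Pi.add_apply, Nat.cast_succ]
      rw [show k + c * ((j : ℤ) + 1) = k + c * j + c by ring]
      ring
  -- The average of `w - w (· + c * j)` over `j < N` is `w` minus a mean of `w`; that mean
  -- telescopes to `(V (k + c * N) - V k) / N`, of size at most `2 * C / N`.
  refine hA.lim _ fun ε hε => ?_
  obtain ⟨N, hN⟩ := exists_nat_gt (2 * C / ε)
  have hN' : (0 : ℝ) < N := lt_of_le_of_lt (by positivity) hN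
  refine ⟨(N : ℝ)⁻¹ • ∑ j ∈ Finset.range N, fun k => w k - w (k + c * j),
    A.smul_mem _ (A.sum_mem fun j _ => htel j), fun k => ?_⟩
  have : ((N : ℝ)⁻¹ • ∑ j ∈ Finset.range N, fun k => w k - w (k + c * j)) k - w k
      = (N : ℝ)⁻¹ * -(V (k + c * N) - V k) := by
    rw [← sum_range_step c V w hVw]
    simp only [Pi.smul_apply, Finset.sum_apply, Finset.sum_sub_distrib,
      Finset.sum_const, Finset.card_range, smul_eq_mul, nsmul_eq_mul]
    field_simp
    ring
  rw [this, abs_mul, abs_of_pos (inv_pos.mpr hN'), inv_mul_le_iff₀ hN', abs_neg]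
  have h1 := abs_sub (V (k + c * N)) (V k)
  have h2 := hV (k + c * N)
  have h3 := hV k
  rw [div_lt_iff₀ hε] at hN
  have h4 : |V (k + c * N) - V k| ≤ 2 * C := by
    rw [abs_le] at *
    constructor <;> linarith
  linarith

end IsClosedInvariant

/-! ### The Thue–Morse sequence with values `±1` -/

theorem zeta_zero_right (a : Fin 2) : zeta a 0 = a := by
  fin_cases a <;> rfl

theorem zeta_one_right (a : Fin 2) : zeta a 1 = 1 - a := by
  fin_cases a <;> rfl

theorem thueMorse_two_mul (n : ℕ) : thueMorse (2 * n) = thueMorse n := by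
  conv_lhs => rw [← zetaWord_thueMorse]
  rw [zetaWord, Nat.mul_div_cancel_left _ (by norm_num)]
  have : Fin.ofNat 2 (2 * n) = 0 := by ext; simp
  rw [this, zeta_zero_right]

theorem thueMorse_two_mul_add_one (n : ℕ) : thueMorse (2 * n + 1) = 1 - thueMorse n := by
  conv_lhs => rw [← zetaWord_thueMorse]
  rw [zetaWord, show (2 * n + 1) / 2 = n by omega]
  have : Fin.ofNat 2 (2 * n + 1) = 1 := by ext; simp [Nat.add_mod]
  rw [this, zeta_one_right]

/-- The sign of a letter. -/
def sgn (a : Fin 2) : ℝ := if a = 0 then 1 else -1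

theorem sgn_one_sub (a : Fin 2) : sgn (1 - a) = -sgn a := by
  fin_cases a <;> simp [sgn]

theorem sgn_injective : Function.Injective sgn := by
  intro a b
  fin_cases a <;> fin_cases b <;> norm_num [sgn]

/-- The bilateral Thue–Morse sequence with values `±1`. -/
def tau (k : ℤ) : ℝ := sgn (biThueMorse k)

theorem tau_eq_or (k : ℤ) : tau k = 1 ∨ tau k = -1 := by
  unfold tau sgn
  split_ifs <;> simp

theorem tau_mul_self (k : ℤ) : tau k * tau k = 1 := by
  rcases tau_eq_or k with h | h <;> simp [h]

theorem abs_tau (k : ℤ) : |tau k| = 1 := by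
  rcases tau_eq_or k with h | h <;> simp [h]

theorem tau_natCast (n : ℕ) : tau n = sgn (thueMorse n) := rfl

theorem tau_negSucc (n : ℕ) : tau (Int.negSucc n) = tau n := rfl

theorem tau_zero : tau 0 = 1 := by
  have := tau_natCast 0
  simpa [thueMorse, sgn] using this

theorem tau_natCast_two_mul (n : ℕ) : tau ((2 * n : ℕ) : ℤ) = tau n := by
  rw [tau_natCast, tau_natCast, thueMorse_two_mul]

theorem tau_natCast_two_mul_add_one (n : ℕ) : tau ((2 * n + 1 : ℕ) : ℤ) = -tau n := by
  rw [tau_natCast, tau_natCast, thueMorse_two_mul_add_one, sgn_one_sub]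

theorem tau_natCast_four_mul (n : ℕ) :
    tau ((4 * n : ℕ) : ℤ) = tau n ∧ tau ((4 * n + 1 : ℕ) : ℤ) = -tau n ∧
    tau ((4 * n + 2 : ℕ) : ℤ) = -tau n ∧ tau ((4 * n + 3 : ℕ) : ℤ) = tau n := by
  refine ⟨?_, ?_, ?_, ?_⟩
  · rw [show 4 * n = 2 * (2 * n) by ring, tau_natCast_two_mul, tau_natCast_two_mul]
  · rw [show 4 * n + 1 = 2 * (2 * n) + 1 by ring, tau_natCast_two_mul_add_one,
      tau_natCast_two_mul]
  · rw [show 4 * n + 2 = 2 * (2 * n + 1) by ring, tau_natCast_two_mul,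
      tau_natCast_two_mul_add_one]
  · rw [show 4 * n + 3 = 2 * (2 * n + 1) + 1 by ring, tau_natCast_two_mul_add_one,
      tau_natCast_two_mul_add_one, neg_neg]

/-- The square of the substitution has palindromic blocks `+--+`, so the reflected left half obeys
the same rule as the right half. This is why the scale is 4 and not 2. -/
theorem tau_four_mul_all (j : ℤ) :
    tau (4 * j) = tau j ∧ tau (4 * j + 1) = -tau j ∧
    tau (4 * j + 2) = -tau j ∧ tau (4 * j + 3) = tau j := by
  obtain ⟨n, rfl | rfl⟩ : ∃ n : ℕ, j = n ∨ j = Int.negSucc n := by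
    cases j with
    | ofNat n => exact ⟨n, Or.inl rfl⟩
    | negSucc n => exact ⟨n, Or.inr rfl⟩
  · exact_mod_cast tau_natCast_four_mul n
  · obtain ⟨h0, h1, h2, h3⟩ := tau_natCast_four_mul n
    rw [show 4 * Int.negSucc n = Int.negSucc (4 * n + 3) by omega,
      show Int.negSucc (4 * n + 3) + 1 = Int.negSucc (4 * n + 2) by omega,
      show Int.negSucc (4 * n + 3) + 2 = Int.negSucc (4 * n + 1) by omega,
      show Int.negSucc (4 * n + 3) + 3 = Int.negSucc (4 * n) by omega]
    simp only [tau_negSucc]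
    exact ⟨h3, h2, h1, h0⟩

theorem tau_four_mul (j : ℤ) : tau (4 * j) = tau j := (tau_four_mul_all j).1
theorem tau_four_mul_add_one (j : ℤ) : tau (4 * j + 1) = -tau j := (tau_four_mul_all j).2.1
theorem tau_four_mul_add_two (j : ℤ) : tau (4 * j + 2) = -tau j := (tau_four_mul_all j).2.2.1
theorem tau_four_mul_add_three (j : ℤ) : tau (4 * j + 3) = tau j := (tau_four_mul_all j).2.2.2

theorem exists_four_mul_add (k : ℤ) :
    ∃ j, k = 4 * j ∨ k = 4 * j + 1 ∨ k = 4 * j + 2 ∨ k = 4 * j + 3 :=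
  ⟨k / 4, by omega⟩

/-- The letters of the block of order `m` coded by `tau j`. -/
theorem tau_four_pow_mul_add (m : ℕ) (j : ℤ) (i : ℕ) (hi : i < 4 ^ m) :
    tau (4 ^ m * j + i) = tau i * tau j := by
  induction m generalizing i with
  | zero =>
    obtain rfl : i = 0 := by simpa using hi
    simp [tau_zero]
  | succ m ih =>
    have ih' := ih (i / 4) (by rw [pow_succ] at hi; omega)
    obtain ⟨q, hq⟩ : ∃ q, q = i / 4 := ⟨_, rfl⟩
    rw [← hq] at ih'
    have hk : (4 : ℤ) ^ (m + 1) * j + i = 4 * (4 ^ m * j + q) + (i - 4 * q) := by ring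
    rw [hk]
    have : i = 4 * q ∨ i = 4 * q + 1 ∨ i = 4 * q + 2 ∨ i = 4 * q + 3 := by omega
    rcases this with h | h | h | h <;> rw [h] <;> push_cast <;>
      simp only [sub_self, add_zero, add_sub_cancel_left, tau_four_mul, tau_four_mul_add_one,
        tau_four_mul_add_two, tau_four_mul_add_three, ih', neg_mul]

/-- Spreading a sequence over blocks of length `4` with the signs `+--+`. -/
def substitute (w : ℤ → ℝ) (k : ℤ) : ℝ := w (k / 4) * tau (k % 4)

theorem tau_one : tau 1 = -1 := by simpa [tau_zero] using tau_four_mul_add_one 0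
theorem tau_two : tau 2 = -1 := by simpa [tau_zero] using tau_four_mul_add_two 0
theorem tau_three : tau 3 = 1 := by simpa [tau_zero] using tau_four_mul_add_three 0

theorem tau_eq_substitute : tau = substitute tau := by
  funext k
  obtain ⟨j, rfl | rfl | rfl | rfl⟩ := exists_four_mul_add k
  · rw [substitute, show 4 * j / 4 = j by omega, show 4 * j % 4 = 0 by omega, tau_four_mul,
      tau_zero, mul_one]
  · rw [substitute, show (4 * j + 1) / 4 = j by omega, show (4 * j + 1) % 4 = 1 by omega,
      tau_four_mul_add_one, tau_one, mul_neg_one]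
  · rw [substitute, show (4 * j + 2) / 4 = j by omega, show (4 * j + 2) % 4 = 2 by omega,
      tau_four_mul_add_two, tau_two, mul_neg_one]
  · rw [substitute, show (4 * j + 3) / 4 = j by omega, show (4 * j + 3) % 4 = 3 by omega,
      tau_four_mul_add_three, tau_three, mul_one]

/-- For every step `4 ^ n`, the sequence `tau` is a second difference of a bounded sequence. -/
theorem exists_tau_eq_second_difference (n : ℕ) :
    ∃ W : ℤ → ℝ, (∀ k, |W k| ≤ 1) ∧
      ∀ k, W (k + 2 * 4 ^ n) - 2 * W (k + 4 ^ n) + W k = tau k := by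
  induction n with
  | zero =>
    -- The block `+--+` has polynomial `1 - z - z² + z³ = (1 - z)² (1 + z)`; this witness carries
    -- the factor `1 + z`, placed at residues 2 and 3 to match forward differences.
    refine ⟨fun k => if 2 ≤ k % 4 then tau (k / 4) else 0, fun k => ?_, fun k => ?_⟩
    · dsimp only
      split_ifs
      · exact (abs_tau _).le
      · simp
    · obtain ⟨j, rfl | rfl | rfl | rfl⟩ := exists_four_mul_add k
      · simp only [pow_zero, mul_one]
        rw [if_pos (by omega), if_neg (by omega), if_neg (by omega), tau_four_mul,
          show (4 * j + 2) / 4 = j by omega]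
        ring
      · simp only [pow_zero, mul_one]
        rw [if_pos (by omega), if_pos (by omega), if_neg (by omega), tau_four_mul_add_one,
          show (4 * j + 1 + 2) / 4 = j by omega, show (4 * j + 1 + 1) / 4 = j by omega]
        ring
      · simp only [pow_zero, mul_one]
        rw [if_neg (by omega), if_pos (by omega), if_pos (by omega), tau_four_mul_add_two,
          show (4 * j + 2 + 1) / 4 = j by omega, show (4 * j + 2) / 4 = j by omega]
        ring
      · simp only [pow_zero, mul_one]
        rw [if_neg (by omega), if_neg (by omega), if_pos (by omega), tau_four_mul_add_three,
          show (4 * j + 3) / 4 = j by omega]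
        ring
  | succ n ih =>
    obtain ⟨W, hW, h⟩ := ih
    -- A translation by `4 * t` moves `k / 4` by `t` and fixes `k % 4`, so `substitute` turns step
    -- `4 ^ n` into step `4 ^ (n + 1)`.
    refine ⟨substitute W, fun k => ?_, fun k => ?_⟩
    · rw [substitute, abs_mul, abs_tau, mul_one]
      exact hW _
    · rw [tau_eq_substitute]
      simp only [substitute]
      rw [← h (k / 4), show k + 2 * 4 ^ (n + 1) = k + 2 * 4 ^ n * 4 by ring,
        show k + 4 ^ (n + 1) = k + 4 ^ n * 4 by ring,
        Int.add_mul_ediv_right _ _ (by norm_num), Int.add_mul_ediv_right _ _ (by norm_num),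
        Int.add_mul_emod_self_right, Int.add_mul_emod_self_right]
      ring

theorem abs_sum_tau_le (n N : ℕ) (k : ℤ) :
    |∑ j ∈ Finset.range N, tau (k + 4 ^ n * j)| ≤ 4 := by
  obtain ⟨W, hW, h⟩ := exists_tau_eq_second_difference n
  rw [sum_range_step (4 ^ n) (fun k => W (k + 4 ^ n) - W k) tau]
  · have h1 := abs_le.mp (hW (k + 4 ^ n * N + 4 ^ n))
    have h2 := abs_le.mp (hW (k + 4 ^ n * N))
    have h3 := abs_le.mp (hW (k + 4 ^ n))
    have h4 := abs_le.mp (hW k)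
    rw [abs_le]
    constructor <;> linarith
  · intro k
    rw [← h k]
    rw [show k + 4 ^ n + 4 ^ n = k + 2 * 4 ^ n by ring]
    ring

/-- Each of the two summations telescopes one of the two differences, leaving four values of `W`. A
single difference would give only a bound of order `N`. -/
theorem abs_fejer_sum_tau_le (n N : ℕ) (k : ℤ) :
    |∑ a ∈ Finset.range N, ∑ b ∈ Finset.range N, tau (k + 4 ^ n * ((a : ℤ) - b))| ≤ 4 := by
  obtain ⟨W, hW, h⟩ := exists_tau_eq_second_difference n
  set c : ℤ := 4 ^ n with hc
  have h1 : ∀ b : ℕ, ∑ a ∈ Finset.range N, tau (k + c * ((a : ℤ) - b)) =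
      (W (k + c * N - c * b + c) - W (k + c * N - c * b)) - (W (k - c * b + c) - W (k - c * b)) := by
    intro b
    have := sum_range_step c (fun k => W (k + c) - W k) tau (fun k => by
      rw [← h k]
      rw [show k + c + c = k + 2 * c by ring]
      ring) (k - c * b) N
    rw [show k + c * N - c * b = k - c * b + c * N by ring, ← this]
    refine Finset.sum_congr rfl fun a _ => congrArg tau (by ring)
  have h2 : ∀ x : ℤ, ∑ b ∈ Finset.range N, (W (x - c * b + c) - W (x - c * b)) =
      W (x + c) - W (x + c - c * N) := by
    intro x
    have := Finset.sum_range_sub' (fun j : ℕ => W (x + c - c * j)) N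
    simp only [Nat.cast_zero, mul_zero, sub_zero] at this
    rw [← this]
    refine Finset.sum_congr rfl fun j _ => ?_
    congr 2
    · ring
    · push_cast; ring
  rw [Finset.sum_comm, Finset.sum_congr rfl fun b _ => h1 b, Finset.sum_sub_distrib, h2, h2]
  have e1 := abs_le.mp (hW (k + c * N + c))
  have e2 := abs_le.mp (hW (k + c * N + c - c * N))
  have e3 := abs_le.mp (hW (k + c))
  have e4 := abs_le.mp (hW (k + c - c * N))
  rw [abs_le]
  constructor <;> linarith

/-- The product of two neighbouring signs. -/
def gee (k : ℤ) : ℝ := tau (k - 1) * tau k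

theorem gee_four_mul (j : ℤ) : gee (4 * j) = gee j := by
  rw [gee, gee, show 4 * j - 1 = 4 * (j - 1) + 3 by ring, tau_four_mul_add_three, tau_four_mul]

theorem gee_four_mul_add_one (j : ℤ) : gee (4 * j + 1) = -1 := by
  rw [gee, show 4 * j + 1 - 1 = 4 * j by ring, tau_four_mul, tau_four_mul_add_one, mul_neg,
    tau_mul_self]

theorem gee_four_mul_add_two (j : ℤ) : gee (4 * j + 2) = 1 := by
  rw [gee, show 4 * j + 2 - 1 = 4 * j + 1 by ring, tau_four_mul_add_one, tau_four_mul_add_two,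
    neg_mul_neg, tau_mul_self]

theorem gee_four_mul_add_three (j : ℤ) : gee (4 * j + 3) = -1 := by
  rw [gee, show 4 * j + 3 - 1 = 4 * j + 2 by ring, tau_four_mul_add_two, tau_four_mul_add_three,
    neg_mul, tau_mul_self]

theorem abs_gee (k : ℤ) : |gee k| = 1 := by
  rw [gee, abs_mul, abs_tau, abs_tau, mul_one]

theorem gee_four_pow_mul (m : ℕ) (j : ℤ) : gee (4 ^ m * j) = gee j := by
  induction m with
  | zero => simp
  | succ m ih => rw [pow_succ', mul_assoc, gee_four_mul, ih]

/-- Off the multiples of `4 ^ m`, the sequence `gee` is `4 ^ m`-periodic. -/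
theorem gee_add_four_pow_mul (m : ℕ) {k : ℤ} (hk : ¬ (4 : ℤ) ^ m ∣ k) (j : ℤ) :
    gee (k + 4 ^ m * j) = gee k := by
  induction m generalizing k with
  | zero => simp at hk
  | succ m ih =>
    obtain ⟨q, rfl | rfl | rfl | rfl⟩ := exists_four_mul_add k
    · rw [show 4 * q + 4 ^ (m + 1) * j = 4 * (q + 4 ^ m * j) by ring, gee_four_mul, gee_four_mul]
      refine ih fun h => hk ?_
      rw [pow_succ']
      exact mul_dvd_mul_left _ h
    · rw [show 4 * q + 1 + 4 ^ (m + 1) * j = 4 * (q + 4 ^ m * j) + 1 by ring,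
        gee_four_mul_add_one, gee_four_mul_add_one]
    · rw [show 4 * q + 2 + 4 ^ (m + 1) * j = 4 * (q + 4 ^ m * j) + 2 by ring,
        gee_four_mul_add_two, gee_four_mul_add_two]
    · rw [show 4 * q + 3 + 4 ^ (m + 1) * j = 4 * (q + 4 ^ m * j) + 3 by ring,
        gee_four_mul_add_three, gee_four_mul_add_three]

/-! ### Uniform averages of `gee` -/

theorem sum_range_four_mul (f : ℕ → ℝ) (M : ℕ) :
    ∑ j ∈ Finset.range (4 * M), f j =
      ∑ j ∈ Finset.range M, (f (4 * j) + f (4 * j + 1) + f (4 * j + 2) + f (4 * j + 3)) := by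
  induction M with
  | zero => simp
  | succ M ih =>
    rw [Finset.sum_range_succ, ← ih, show 4 * (M + 1) = 4 * M + 1 + 1 + 1 + 1 by ring]
    simp only [Finset.sum_range_succ]
    ring

/-- The values `-1, 1, -1` at nonzero residues modulo 4 cancel against three copies of `1 / 3`, so
only multiples of 4 survive, where `gee` reproduces itself. -/
theorem sum_gee_block (n : ℕ) (q : ℤ) :
    ∑ j ∈ Finset.range (4 ^ n), (gee (4 ^ n * q + j) + 1 / 3) = gee q + 1 / 3 := by
  induction n generalizing q with
  | zero => simp
  | succ n ih =>
    rw [← ih q, pow_succ', sum_range_four_mul]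
    refine Finset.sum_congr rfl fun j _ => ?_
    have h (i : ℤ) : 4 ^ (n + 1) * q + (4 * (j : ℤ) + i) = 4 * (4 ^ n * q + j) + i := by ring
    have h0 := h 0
    rw [add_zero, add_zero] at h0
    push_cast
    rw [h0, h 1, h 2, h 3, gee_four_mul, gee_four_mul_add_one, gee_four_mul_add_two,
      gee_four_mul_add_three]
    ring

theorem abs_gee_add_third_le (k : ℤ) : |gee k + 1 / 3| ≤ 4 / 3 := by
  have := abs_le.mp (abs_gee k).le
  rw [abs_le]
  constructor <;> linarith

/-- The mean of `gee` is `-1 / 3`, uniformly over all windows. -/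
theorem abs_sum_gee_le (n : ℕ) (q : ℤ) :
    |∑ j ∈ Finset.range (4 ^ n), (gee (q + j) + 1 / 3)| ≤ 4 / 3 := by
  have hpos : (0 : ℤ) < 4 ^ n := by positivity
  have hstep (q : ℤ) : ∑ j ∈ Finset.range (4 ^ n), (gee (q + 1 + j) + 1 / 3) =
      ∑ j ∈ Finset.range (4 ^ n), (gee (q + j) + 1 / 3) + (gee (q + 4 ^ n) - gee q) := by
    have h1 := Finset.sum_range_succ (fun j : ℕ => gee (q + j) + 1 / 3) (4 ^ n)
    have h2 := Finset.sum_range_succ' (fun j : ℕ => gee (q + j) + 1 / 3) (4 ^ n)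
    push_cast at h1 h2
    rw [add_zero] at h2
    have h3 : ∑ j ∈ Finset.range (4 ^ n), (gee (q + 1 + j) + 1 / 3) =
        ∑ j ∈ Finset.range (4 ^ n), (gee (q + (j + 1)) + 1 / 3) :=
      Finset.sum_congr rfl fun j _ => by rw [add_assoc, add_comm (1 : ℤ)]
    rw [h3]
    linarith
  -- Sliding a window of length `4 ^ n` changes its sum only when a multiple of `4 ^ n` leaves. The
  -- sum is thus governed by the single multiple `4 ^ n * (t + 1)` inside.
  have key (t : ℤ) (i : ℕ) (hi : i < 4 ^ n) :
      ∑ j ∈ Finset.range (4 ^ n), (gee (4 ^ n * t + i + 1 + j) + 1 / 3) = gee (t + 1) + 1 / 3 := by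
    induction i with
    | zero =>
      rw [hstep]
      simp only [Nat.cast_zero, add_zero]
      rw [sum_gee_block, show (4 : ℤ) ^ n * t + 4 ^ n = 4 ^ n * (t + 1) by ring,
        gee_four_pow_mul, gee_four_pow_mul]
      ring
    | succ i ih =>
      have hnd : ¬ (4 : ℤ) ^ n ∣ 4 ^ n * t + (i + 1 : ℕ) := by
        rw [Int.dvd_add_right (Dvd.intro _ rfl)]
        intro h
        have := Int.le_of_dvd (by positivity) h
        have hi' : ((i + 1 : ℕ) : ℤ) < 4 ^ n := by exact_mod_cast hi
        omega
      have hper := gee_add_four_pow_mul n hnd 1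
      rw [mul_one] at hper
      rw [hstep, hper, ← ih (by omega)]
      push_cast
      rw [sub_self, add_zero, ← add_assoc]
  obtain ⟨i, hi⟩ := Int.eq_ofNat_of_zero_le (Int.emod_nonneg (q - 1) hpos.ne')
  have hlt : i < 4 ^ n := by
    have := Int.emod_lt_of_pos (q - 1) hpos
    rw [hi] at this
    exact_mod_cast this
  have hq : q = 4 ^ n * ((q - 1) / 4 ^ n) + i + 1 := by
    have := Int.mul_ediv_add_emod (q - 1) (4 ^ n)
    rw [hi] at this
    linarith
  rw [hq, key _ _ hlt]
  exact abs_gee_add_third_le _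

/-! ### The closed invariant space generated by `tau + gee` -/

theorem inflate_four_of_residues (w : ℤ → ℝ) (j : ℤ) :
    inflate 4 w (4 * j) = w j ∧ inflate 4 w (4 * j + 1) = 0 ∧
    inflate 4 w (4 * j + 2) = 0 ∧ inflate 4 w (4 * j + 3) = 0 :=
  ⟨inflate_mul_self (c := 4) (by norm_num) w j, inflate_of_not_dvd w (by omega),
    inflate_of_not_dvd w (by omega), inflate_of_not_dvd w (by omega)⟩

namespace IsClosedInvariant

variable {A : Submodule ℝ (ℤ → ℝ)}

/-- Subtracting `gee + 1 / 3` on the multiples of `4 ^ m` replaces `gee` there by its mean, giving a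
`4 ^ m`-periodic sequence. The discarded part and `tau` both average to zero along `4 ^ m`. -/
theorem gee_sub_inflate_mem (hA : IsClosedInvariant A) (hf : tau + gee ∈ A) (m : ℕ) :
    gee - inflate (4 ^ m) (fun k => gee k + 1 / 3) ∈ A := by
  have hpos : 0 < 4 ^ m := by positivity
  refine hA.mem_of_average (w := tau + inflate (4 ^ m) (fun k => gee k + 1 / 3)) (4 ^ m)
    (by convert hf using 1; abel) (fun k => ?_) fun ε hε => ?_
  · by_cases hk : ((4 ^ m : ℕ) : ℤ) ∣ k
    · obtain ⟨j, rfl⟩ := hk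
      have : ((4 ^ m : ℕ) : ℤ) * j + 4 ^ m = (4 ^ m : ℕ) * (j + 1) := by push_cast; ring
      rw [this]
      simp only [Pi.sub_apply, inflate_mul_self hpos]
      push_cast
      rw [gee_four_pow_mul, gee_four_pow_mul]
      ring
    · have hk' : ¬ ((4 ^ m : ℕ) : ℤ) ∣ k + 4 ^ m := by
        rwa [Int.dvd_add_left (Dvd.intro 1 (by push_cast; ring))]
      simp only [Pi.sub_apply, inflate_of_not_dvd _ hk, inflate_of_not_dvd _ hk']
      have := gee_add_four_pow_mul m (by exact_mod_cast hk) 1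
      rw [mul_one] at this
      rw [this]
  -- The two sums are bounded by `4` and `4 / 3`, together below `6`.
  · obtain ⟨n, hn⟩ := pow_unbounded_of_one_lt (6 / ε) (by norm_num : (1 : ℝ) < 4)
    rw [div_lt_iff₀ hε] at hn
    refine ⟨4 ^ n, by positivity, fun k => ?_⟩
    simp only [Pi.add_apply, Finset.sum_add_distrib]
    have h1 := abs_le.mp (abs_sum_tau_le m (4 ^ n) k)
    have h2 : |∑ j ∈ Finset.range (4 ^ n),
        inflate (4 ^ m) (fun k => gee k + 1 / 3) (k + 4 ^ m * j)| ≤ 4 / 3 := by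
      by_cases hk : ((4 ^ m : ℕ) : ℤ) ∣ k
      · obtain ⟨q, rfl⟩ := hk
        have (j : ℕ) : ((4 ^ m : ℕ) : ℤ) * q + 4 ^ m * j = (4 ^ m : ℕ) * (q + j) := by
          push_cast; ring
        simp only [this, inflate_mul_self hpos]
        exact abs_sum_gee_le n q
      · rw [Finset.sum_eq_zero]
        · norm_num
        · intro j _
          refine inflate_of_not_dvd _ ?_
          rwa [Int.dvd_add_left (Dvd.intro (j : ℤ) (by push_cast; ring))]
    have h3 := abs_le.mp h2
    push_cast
    rw [abs_le]
    constructor <;> linarith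

/-- The sequence `d` is 4-periodic with values `0, 2/3, -4/3, 2/3`. Its Fourier coefficients at the
three nontrivial characters modulo 4 are nonzero and the constants supply the trivial one, so all
4-periodic sequences are reached. -/
theorem inflate_four_one_mem (hA : IsClosedInvariant A) (h1 : (fun _ => 1) ∈ A)
    (hd : inflate 4 (fun k => gee k + 1 / 3) - (fun k => gee k + 1 / 3) ∈ A) :
    inflate 4 (fun _ => 1) ∈ A := by
  set d := inflate 4 (fun k => gee k + 1 / 3) - (fun k => gee k + 1 / 3) with hd_def
  have hdj (j : ℤ) : d (4 * j) = 0 ∧ d (4 * j + 1) = 2 / 3 ∧ d (4 * j + 2) = -4 / 3 ∧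
      d (4 * j + 3) = 2 / 3 := by
    obtain ⟨e0, e1, e2, e3⟩ := inflate_four_of_residues (fun k => gee k + 1 / 3) j
    simp only [hd_def, Pi.sub_apply, e0, e1, e2, e3, gee_four_mul, gee_four_mul_add_one,
      gee_four_mul_add_two, gee_four_mul_add_three]
    norm_num
  -- By the symmetry of `d`, the coefficients solve three equations, at residues `0`, `±1` and `2`.
  have := A.add_mem (A.add_mem (A.smul_mem (1 / 4 : ℝ) h1) (A.smul_mem (3 / 4 : ℝ) hd))
    (A.smul_mem (9 / 16 : ℝ) (A.add_mem (hA.shift d hd (-1)) (hA.shift d hd 1)))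
  convert this using 1
  funext k
  simp only [Pi.add_apply, Pi.smul_apply, smul_eq_mul]
  obtain ⟨j, hk⟩ := exists_four_mul_add k
  obtain ⟨e0, e1, e2, e3⟩ := inflate_four_of_residues (fun _ => 1) j
  obtain ⟨d0, d1, d2, d3⟩ := hdj j
  rcases hk with rfl | rfl | rfl | rfl
  · rw [e0, d0, d1, show 4 * j + -1 = 4 * (j - 1) + 3 by ring, (hdj _).2.2.2]
    norm_num
  · rw [e1, d1, show 4 * j + 1 + -1 = 4 * j by ring, show 4 * j + 1 + 1 = 4 * j + 2 by ring,
      d0, d2]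
    norm_num
  · rw [e2, d2, show 4 * j + 2 + -1 = 4 * j + 1 by ring, show 4 * j + 2 + 1 = 4 * j + 3 by ring,
      d1, d3]
    norm_num
  · rw [e3, d3, show 4 * j + 3 + -1 = 4 * j + 2 by ring, show 4 * j + 3 + 1 = 4 * (j + 1) by ring,
      d2, (hdj _).1]
    norm_num

theorem inflate_one_mem (hA : IsClosedInvariant A) (hf : tau + gee ∈ A) (m : ℕ) :
    inflate (4 ^ m) (fun _ => 1) ∈ A := by
  induction m with
  | zero =>
    -- At `m = 0` the periodic part is the constant `-1 / 3`.
    have := A.smul_mem (-3 : ℝ) (hA.gee_sub_inflate_mem hf 0)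
    rw [pow_zero, inflate_one] at this ⊢
    convert this using 1
    funext k
    simp only [Pi.smul_apply, Pi.sub_apply, smul_eq_mul]
    ring
  | succ m ih =>
    have hpos : 0 < 4 ^ m := by positivity
    rw [pow_succ, ← inflate_inflate hpos (by norm_num)]
    refine (hA.comap_inflate hpos).inflate_four_one_mem ih ?_
    rw [Submodule.mem_comap, map_sub, inflate_inflate hpos (by norm_num), ← pow_succ]
    convert A.sub_mem (hA.gee_sub_inflate_mem hf m) (hA.gee_sub_inflate_mem hf (m + 1)) using 1
    abel

theorem gee_sub_inflate_gee_mem (hA : IsClosedInvariant A)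
    (h1 : ∀ m, inflate (4 ^ m) (fun _ => 1) ∈ A) (m : ℕ) :
    gee - inflate (4 ^ m) gee ∈ A := by
  have hpos : 0 < 4 ^ m := by positivity
  rw [eq_sum_inflate hpos (gee - inflate (4 ^ m) gee)]
  refine A.sum_mem fun i hi => hA.shift _ ?_ _
  by_cases h0 : i = 0
  · convert A.zero_mem
    convert map_zero (inflate (4 ^ m)) using 2
    funext j
    subst h0
    simp only [Nat.cast_zero, add_zero, Pi.sub_apply, inflate_mul_self hpos, Pi.zero_apply]
    push_cast
    rw [gee_four_pow_mul, sub_self]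
  · have hnd : ¬ ((4 ^ m : ℕ) : ℤ) ∣ i := by
      rw [Int.natCast_dvd_natCast]
      exact Nat.not_dvd_of_pos_of_lt (by omega) (Finset.mem_range.mp hi)
    convert A.smul_mem (gee i) (h1 m) using 1
    rw [← map_smul]
    congr 1
    funext j
    have hnd' : ¬ ((4 ^ m : ℕ) : ℤ) ∣ (4 ^ m : ℕ) * j + i := by
      rwa [Int.dvd_add_right (Dvd.intro _ rfl)]
    simp only [Pi.sub_apply, inflate_of_not_dvd _ hnd', Pi.smul_apply, smul_eq_mul, mul_one,
      sub_zero]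
    rw [add_comm]
    push_cast
    exact gee_add_four_pow_mul m (by exact_mod_cast hnd) j

end IsClosedInvariant

/-! ### Separating `gee` from `tau` -/

theorem dilated_difference_injective {N : ℕ} {i i' : ℕ} {d d' : ℤ} (hd : d ≠ 0)
    (hd' : d' ≠ 0) (hdN : |d| < N) (hdN' : |d'| < N) (h : (N : ℤ) ^ i * d = N ^ i' * d') :
    i = i' ∧ d = d' := by
  have hN : (N : ℤ) ≠ 0 := by
    have := abs_nonneg d
    omega
  have aux {i i' : ℕ} {d d' : ℤ} (hd : d ≠ 0) (hdN : |d| < N)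
      (h : (N : ℤ) ^ i * d = N ^ i' * d') : i' ≤ i := by
    by_contra! hlt
    obtain ⟨t, rfl⟩ := Nat.exists_eq_add_of_lt hlt
    have h2 : d = N * (N ^ t * d') := by
      apply mul_left_cancel₀ (pow_ne_zero i hN)
      rw [h]
      ring
    exact hd (Int.eq_zero_of_abs_lt_dvd (Dvd.intro _ h2.symm) hdN)
  obtain rfl : i = i' := le_antisymm (aux hd' hdN' h.symm) (aux hd hdN h)
  exact ⟨rfl, mul_left_cancel₀ (pow_ne_zero i hN) h⟩

/-- Few of the off-diagonal points `k + N ^ i * (a - b)` lie on a sparse lattice. -/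
theorem card_dilated_difference_le (M N : ℕ) (k c : ℤ) (hc : 2 * (N : ℤ) ^ M ≤ c) :
    (((Finset.range M) ×ˢ (Finset.range N ×ˢ Finset.range N)).filter
      fun p => p.2.1 ≠ p.2.2 ∧ c ∣ k + N ^ p.1 * ((p.2.1 : ℤ) - p.2.2)).card ≤ N := by
  -- For fixed `b` at most one triple counts: two offsets smaller than `N ^ M` in absolute value,
  -- congruent modulo `c ≥ 2 * N ^ M`, are equal, and a nonzero offset determines both `i` and `a -
  -- b`.
  refine (Finset.card_le_card_of_injOn (t := Finset.range N) (fun p => p.2.2)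
    (fun p hp => ?_) ?_).trans (Finset.card_range N).le
  · simp only [Finset.coe_filter, Finset.mem_product, Set.mem_ofPred_eq] at hp
    exact_mod_cast hp.1.2.2
  · rintro ⟨i, a, b⟩ hp ⟨i', a', b'⟩ hp' hb
    simp only [Finset.coe_filter, Finset.mem_product, Finset.mem_range, Set.mem_ofPred_eq] at hp hp'
    obtain rfl : b = b' := hb
    obtain ⟨⟨hi, ha, hb⟩, hne, hdvd⟩ := hp
    obtain ⟨⟨hi', ha', -⟩, hne', hdvd'⟩ := hp'
    have hsize {i a : ℕ} (hi : i < M) (ha : a < N) :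
        |(N : ℤ) ^ i * ((a : ℤ) - b)| < N ^ M := by
      have h1 : |(a : ℤ) - b| < N := by
        rw [abs_lt]
        constructor <;> omega
      have hN : (0 : ℤ) < N := by omega
      rw [abs_mul, abs_of_pos (pow_pos hN i)]
      calc (N : ℤ) ^ i * |(a : ℤ) - b| < N ^ i * N :=
            mul_lt_mul_of_pos_left h1 (pow_pos hN i)
        _ = N ^ (i + 1) := (pow_succ _ _).symm
        _ ≤ N ^ M := pow_le_pow_right₀ (by omega) hi
    have h1 := abs_lt.mp (hsize hi ha)
    have h2 := abs_lt.mp (hsize hi' ha')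
    have heq : (N : ℤ) ^ i * ((a : ℤ) - b) = N ^ i' * ((a' : ℤ) - b) := by
      have := Int.eq_zero_of_abs_lt_dvd (dvd_sub hdvd hdvd') (by
        rw [abs_lt]
        constructor <;> linarith)
      linarith
    obtain ⟨rfl, h3⟩ := dilated_difference_injective (by omega) (by omega)
      (by rw [abs_lt]; constructor <;> omega) (by rw [abs_lt]; constructor <;> omega) heq
    obtain rfl : a = a' := by omega
    rfl

theorem abs_inflate_le {c : ℕ} {w : ℤ → ℝ} {C : ℝ} (hw : ∀ k, |w k| ≤ C) (k : ℤ) :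
    |inflate c w k| ≤ C := by
  have := abs_inflate_sub_le (c := c) (v := w) (w := 0) ((abs_nonneg _).trans (hw 0))
    (by simpa using hw) k
  simpa using this

namespace IsClosedInvariant

variable {A : Submodule ℝ (ℤ → ℝ)}

theorem gee_mem (hA : IsClosedInvariant A) (hf : tau + gee ∈ A) : gee ∈ A := by
  refine hA.lim _ fun ε hε => ?_
  -- The final error is at most `4 / N + 1 / M` with `N = 4 ^ L`; each term is made smaller than `ε
  -- / 2`.
  obtain ⟨L, hL⟩ := pow_unbounded_of_one_lt (8 / ε) (by norm_num : (1 : ℝ) < 4)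
  obtain ⟨M, hM⟩ := exists_nat_gt (2 / ε)
  have hM0 : (0 : ℝ) < M := lt_trans (by positivity) hM
  rw [div_lt_iff₀ hε] at hL hM
  obtain ⟨N, hN⟩ : ∃ N : ℕ, N = 4 ^ L := ⟨_, rfl⟩
  have hNr : (N : ℝ) = 4 ^ L := by rw [hN]; push_cast; rfl
  have hN0 : (0 : ℝ) < N := by rw [hNr]; positivity
  rw [← hNr] at hL
  -- A power of 4, so that `r` below lies in `A`, and at least `2 * N ^ M`, as the counting lemma
  -- needs.
  set c : ℕ := 4 ^ (L * M + 1) with hc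
  have hcN : 2 * (N : ℤ) ^ M ≤ c := by
    rw [hc, hN, pow_succ, pow_mul]
    push_cast
    have : (0 : ℤ) < (4 ^ L) ^ M := by positivity
    linarith
  set r := gee - inflate c gee with hr_def
  have hr : r ∈ A := hA.gee_sub_inflate_gee_mem (hA.inflate_one_mem hf) _
  set P := Finset.range M ×ˢ (Finset.range N ×ˢ Finset.range N) with hP
  set e : ℕ × ℕ × ℕ → ℤ := fun p => N ^ p.1 * ((p.2.1 : ℤ) - p.2.2) with he
  -- Off the diagonal, subtracting the translate of `r` leaves only `inflate c gee` besides `tau`.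
  -- The `M * N` diagonal terms have zero offset and each contributes `gee k`.
  refine ⟨((M : ℝ) * N)⁻¹ • ∑ p ∈ P, ((fun x => (tau + gee) (x + e p)) -
    if p.2.1 = p.2.2 then 0 else fun x => r (x + e p)), A.smul_mem _ (A.sum_mem fun p _ =>
      A.sub_mem (hA.shift _ hf _) ?_), fun k => ?_⟩
  · split_ifs
    · exact A.zero_mem
    · exact hA.shift _ hr _
  have hsplit (p : ℕ × ℕ × ℕ) : ((fun x => (tau + gee) (x + e p)) -
      if p.2.1 = p.2.2 then 0 else fun x => r (x + e p)) k =
      tau (k + e p) + (if p.2.1 = p.2.2 then gee k else 0) +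
        (if p.2.1 = p.2.2 then 0 else inflate c gee (k + e p)) := by
    by_cases h : p.2.1 = p.2.2
    · have : e p = 0 := by simp [he, h]
      simp [h, this]
    · simp only [h, if_false, Pi.sub_apply, hr_def, Pi.add_apply]
      ring
  have hdiag : ∑ p ∈ P, (if p.2.1 = p.2.2 then gee k else 0) = M * N * gee k := by
    rw [hP, Finset.sum_product]
    simp only [Finset.sum_product, Finset.sum_ite_eq, Finset.mem_range, Finset.sum_const,
      Finset.card_range, nsmul_eq_mul]
    rw [Finset.sum_congr rfl fun x hx => if_pos (Finset.mem_range.mp hx)]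
    simp only [Finset.sum_const, Finset.card_range, nsmul_eq_mul]
    ring
  have htau : |∑ p ∈ P, tau (k + e p)| ≤ M * 4 := by
    rw [hP, Finset.sum_product]
    refine (Finset.abs_sum_le_sum_abs _ _).trans ?_
    refine (Finset.sum_le_card_nsmul _ _ 4 fun i _ => ?_).trans (by simp)
    rw [Finset.sum_product]
    have := abs_fejer_sum_tau_le (L * i) N k
    rw [pow_mul, show (4 : ℤ) ^ L = N by rw [hN]; push_cast; rfl] at this
    exact this
  have hoff : |∑ p ∈ P, (if p.2.1 = p.2.2 then 0 else inflate c gee (k + e p))| ≤ N := by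
    refine (Finset.abs_sum_le_sum_abs _ _).trans ?_
    have hcard := card_dilated_difference_le M N k c hcN
    have hcard' : ((P.filter fun p => p.2.1 ≠ p.2.2 ∧ (c : ℤ) ∣ k + e p).card : ℝ) ≤ N :=
      Nat.cast_le.mpr hcard
    refine le_trans ?_ hcard'
    rw [Finset.card_filter]
    push_cast
    refine Finset.sum_le_sum fun p _ => ?_
    by_cases h : p.2.1 = p.2.2
    · simp [h]
    · by_cases h' : (c : ℤ) ∣ k + e p
      · simp only [h, if_false, ne_eq, not_false_eq_true, h', and_self, if_true]
        exact abs_inflate_le (fun k => (abs_gee k).le) _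
      · simp [h, h', inflate_of_not_dvd]
  have hval : (((M : ℝ) * N)⁻¹ • ∑ p ∈ P, ((fun x => (tau + gee) (x + e p)) -
      if p.2.1 = p.2.2 then 0 else fun x => r (x + e p))) k - gee k =
      ((M : ℝ) * N)⁻¹ * (∑ p ∈ P, tau (k + e p) +
        ∑ p ∈ P, (if p.2.1 = p.2.2 then 0 else inflate c gee (k + e p))) := by
    rw [Pi.smul_apply, Finset.sum_apply, Finset.sum_congr rfl fun p _ => hsplit p,
      Finset.sum_add_distrib, Finset.sum_add_distrib, hdiag, smul_eq_mul]
    field_simp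
    ring
  rw [hval, abs_mul, abs_of_pos (by positivity), inv_mul_le_iff₀ (by positivity)]
  have h3 := abs_add_le (∑ p ∈ P, tau (k + e p))
    (∑ p ∈ P, (if p.2.1 = p.2.2 then 0 else inflate c gee (k + e p)))
  have h4 : (M : ℝ) * 8 ≤ M * (ε * N) := by gcongr; linarith
  have h5 : (N : ℝ) * 2 ≤ N * (ε * M) := by gcongr; linarith
  linarith

/-- With `S` the translation by one, `(1 - S) (1 - S²)` sends `inflate 4 tau` to `tau (· + 3)`,
again by the block `+--+`. Both factors can be inverted inside `A` because the relevant sums are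
bounded. -/
theorem inflate_four_tau_mem (hA : IsClosedInvariant A) (h : tau ∈ A) : inflate 4 tau ∈ A := by
  obtain ⟨W, hW, hWtau⟩ := exists_tau_eq_second_difference 0
  simp only [pow_zero, mul_one] at hWtau
  have hbd (k : ℤ) : |inflate 4 tau k| ≤ 1 := abs_inflate_le (fun k => (abs_tau k).le) k
  have hV (k : ℤ) : |inflate 4 (fun k => W (k + 1) - W k) k| ≤ 2 := by
    refine abs_inflate_le (fun k => ?_) k
    have h1 := abs_le.mp (hW k)
    have h2 := abs_le.mp (hW (k + 1))
    rw [abs_le]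
    constructor <;> linarith
  -- Since `tau` is a difference with step 1, its inflation is one with step 4; adding two
  -- translates of the primitive turns step 4 into step 2.
  refine hA.mem_of_sub_shift_mem (C := 4) 2 (V := fun k =>
    inflate 4 (fun k => W (k + 1) - W k) k + inflate 4 (fun k => W (k + 1) - W k) (k + 2))
    (fun k => (abs_add_le _ _).trans (by linarith [hV k, hV (k + 2)])) (fun k => ?_) ?_
  · have h1 := congrFun (inflate_shift (c := 4) (by norm_num) (fun k => W (k + 1) - W k) 1) k
    have h2 : tau = (fun k => W (k + 1 + 1) - W (k + 1)) - fun k => W (k + 1) - W k := by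
      funext k
      rw [← hWtau k, Pi.sub_apply, add_assoc]
      norm_num
      ring
    rw [h2, map_sub, Pi.sub_apply, h1]
    push_cast
    rw [add_assoc k 2 2]
    norm_num
    ring
  refine hA.mem_of_sub_shift_mem (C := 2) 1
    (V := fun k => -(inflate 4 tau k + inflate 4 tau (k + 1)))
    (fun k => ?_) (fun k => ?_) ?_
  · rw [abs_neg]
    exact (abs_add_le _ _).trans (by linarith [hbd k, hbd (k + 1)])
  · rw [add_assoc k 1 1]
    norm_num
    ring
  · convert hA.shift _ h 3 using 1
    funext k
    obtain ⟨j, hk⟩ := exists_four_mul_add k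
    obtain ⟨e0, e1, e2, e3⟩ := inflate_four_of_residues tau j
    obtain ⟨f0, f1, f2, f3⟩ := inflate_four_of_residues tau (j + 1)
    rcases hk with rfl | rfl | rfl | rfl
    · rw [add_assoc (4 * j) 1 2]
      norm_num only
      rw [e0, e1, e2, e3, tau_four_mul_add_three]
      ring
    · rw [show 4 * j + 1 + 3 = 4 * (j + 1) by ring, show 4 * j + 1 + 2 = 4 * j + 3 by ring,
        show 4 * j + 1 + 1 = 4 * j + 2 by ring, show 4 * j + 2 + 2 = 4 * (j + 1) by ring,
        e1, e2, e3, f0, tau_four_mul]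
      ring
    · rw [show 4 * j + 2 + 3 = 4 * (j + 1) + 1 by ring, show 4 * j + 2 + 2 = 4 * (j + 1) by ring,
        show 4 * j + 2 + 1 = 4 * j + 3 by ring, show 4 * j + 3 + 2 = 4 * (j + 1) + 1 by ring,
        e2, e3, f0, f1, tau_four_mul_add_one]
      ring
    · rw [show 4 * j + 3 + 3 = 4 * (j + 1) + 2 by ring,
        show 4 * j + 3 + 2 = 4 * (j + 1) + 1 by ring,
        show 4 * j + 3 + 1 = 4 * (j + 1) by ring,
        show 4 * (j + 1) + 2 = 4 * (j + 1) + 2 by ring, e3, f0, f1, f2, tau_four_mul_add_two]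
      ring

theorem inflate_tau_mem (hA : IsClosedInvariant A) (h : tau ∈ A) (m : ℕ) :
    inflate (4 ^ m) tau ∈ A := by
  induction m with
  | zero => rwa [pow_zero, inflate_one]
  | succ m ih =>
    have hpos : 0 < 4 ^ m := by positivity
    rw [pow_succ, ← inflate_inflate hpos (by norm_num)]
    exact (hA.comap_inflate hpos).inflate_four_tau_mem ih

/-- Every sequence depending on a window of the Thue–Morse sequence lies in `A`. -/
theorem mem_of_window (hA : IsClosedInvariant A) (hf : tau + gee ∈ A) (r : ℕ) (s : ℤ → ℝ)
    (hs : ∀ k k' : ℤ, (∀ i : ℕ, i < r → tau (k + i) = tau (k' + i)) → s k = s k') : s ∈ A := by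
  have hgee := hA.gee_mem hf
  have htau : tau ∈ A := by simpa using A.sub_mem hf hgee
  have hr : r ≤ 4 ^ r := (Nat.lt_pow_self (by norm_num)).le
  have hpos : 0 < 4 ^ r := by positivity
  have h1 := hA.inflate_one_mem hf r
  have h2 := hA.inflate_tau_mem htau r
  have h3 : inflate (4 ^ r) gee ∈ A := by
    have := A.sub_mem hgee (hA.gee_sub_inflate_gee_mem (hA.inflate_one_mem hf) r)
    rwa [sub_sub_cancel] at this
  have hB := hA.comap_inflate hpos
  rw [eq_sum_inflate hpos s]
  refine A.sum_mem fun i hi => hA.shift _ ?_ _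
  have hi := Finset.mem_range.mp hi
  -- As `r ≤ 4 ^ r`, the window meets at most two consecutive blocks of length `4 ^ r`, coded by
  -- `tau j` and `tau (j + 1)`.
  have hfac : Function.FactorsThrough (fun j : ℤ => s ((4 ^ r : ℕ) * j + i))
      (fun j => (tau j, tau (j + 1))) := by
    intro j j' hj
    rw [Prod.mk.injEq] at hj
    refine hs _ _ fun t ht => ?_
    push_cast
    by_cases hlt : i + t < 4 ^ r
    · have e (j : ℤ) : (4 : ℤ) ^ r * j + i + t = 4 ^ r * j + (i + t : ℕ) := by push_cast; ring
      rw [e, e, tau_four_pow_mul_add _ _ _ hlt, tau_four_pow_mul_add _ _ _ hlt, hj.1]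
    · obtain ⟨q, hq⟩ := Nat.exists_eq_add_of_le (not_lt.mp hlt)
      have e (j : ℤ) : (4 : ℤ) ^ r * j + i + t = 4 ^ r * (j + 1) + q := by
        have : (i : ℤ) + t = 4 ^ r + q := by exact_mod_cast hq
        linarith
      have hq' : q < 4 ^ r := by omega
      rw [e, e, tau_four_pow_mul_add _ _ _ hq', tau_four_pow_mul_add _ _ _ hq', hj.2]
  obtain ⟨F, hF⟩ : ∃ F : ℝ × ℝ → ℝ, ∀ j : ℤ, s ((4 ^ r : ℕ) * j + i) = F (tau j, tau (j + 1)) :=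
    ⟨_, fun j => (hfac.extend_apply 0 j).symm⟩
  simp only [hF]
  -- Walsh expansion of `F` on `{1, -1}²`; the product `tau j * tau (j + 1)` is `gee (j + 1)`.
  have := A.add_mem
    (A.add_mem
      (A.smul_mem ((F (1, 1) + F (1, -1) + F (-1, 1) + F (-1, -1)) / 4) h1)
      (A.smul_mem ((F (1, 1) + F (1, -1) - F (-1, 1) - F (-1, -1)) / 4) h2))
    (A.add_mem
      (A.smul_mem ((F (1, 1) - F (1, -1) + F (-1, 1) - F (-1, -1)) / 4) (hB.shift _ h2 1))
      (A.smul_mem ((F (1, 1) - F (1, -1) - F (-1, 1) + F (-1, -1)) / 4) (hB.shift _ h3 1)))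
  simp only [← map_smul, ← map_add] at this
  convert this using 2
  funext j
  simp only [Pi.add_apply, Pi.smul_apply, smul_eq_mul, gee, add_sub_cancel_right]
  rcases tau_eq_or j with h | h <;> rcases tau_eq_or (j + 1) with h' | h' <;> rw [h, h'] <;> ring

end IsClosedInvariant

/-! ### Reduction to sequences -/

section Reduction

variable {A : Type*} [TopologicalSpace A]

/-- The point `σ ^ k u` of the orbit closure. -/
def orbitPoint (u : ℤ → A) (k : ℤ) : orbitClosure u :=
  ⟨fun n => u (n + k), subset_closure ⟨k, rfl⟩⟩

theorem subshift_orbitPoint (u : ℤ → A) (k : ℤ) :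
    subshift u (orbitPoint u k) = orbitPoint u (k + 1) := by
  apply Subtype.ext
  funext n
  change u (n + 1 + k) = u (n + (k + 1))
  congr 1
  ring

theorem dense_range_orbitPoint (u : ℤ → A) : DenseRange (orbitPoint u) := by
  rw [DenseRange, Subtype.dense_iff]
  intro x hx
  have : Subtype.val '' Set.range (orbitPoint u) = Set.range fun (k n : ℤ) => u (n + k) :=
    (Set.range_comp _ _).symm
  rw [this]
  exact hx

theorem compOp_apply_orbitPoint [CompactSpace A] (u : ℤ → A) (φ : C(orbitClosure u, ℝ))
    (k : ℤ) : compOp (subshift u) φ (orbitPoint u k) = φ (orbitPoint u (k + 1)) := by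
  rw [← subshift_orbitPoint]
  rfl

/-- A continuous function on a subshift over a discrete alphabet is determined, up to `ε`, by a
window of coordinates. -/
theorem exists_window [DiscreteTopology A] (X : Set (ℤ → A)) [CompactSpace X] (φ : C(X, ℝ))
    {ε : ℝ} (hε : 0 < ε) :
    ∃ r : ℕ, ∀ x y : X, (∀ i : ℤ, |i| ≤ r → x.1 i = y.1 i) → |φ x - φ y| ≤ ε := by
  have hloc (x : X) : ∃ r : ℕ, ∀ y : X, (∀ i : ℤ, |i| ≤ r → x.1 i = y.1 i) →
      |φ x - φ y| ≤ ε / 2 := by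
    have hU : {y : X | |φ x - φ y| < ε / 2} ∈ nhds x :=
      (isOpen_lt (by fun_prop) continuous_const).mem_nhds (by simpa using hε)
    rw [nhds_subtype_eq_comap, Filter.mem_comap] at hU
    obtain ⟨V, hV, hVU⟩ := hU
    rw [nhds_pi, Filter.mem_pi] at hV
    obtain ⟨I, hI, t, ht, htV⟩ := hV
    obtain ⟨r, hr⟩ : ∃ r : ℕ, ∀ i ∈ I, |i| ≤ r := by
      obtain ⟨b, hb⟩ := (hI.image fun i => i.natAbs).bddAbove
      refine ⟨b, fun i hi => ?_⟩
      have : i.natAbs ≤ b := hb ⟨i, hi, rfl⟩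
      rw [Int.abs_eq_natAbs]
      exact_mod_cast this
    refine ⟨r, fun y hy => le_of_lt (hVU (htV fun i hi => ?_))⟩
    rw [← hy i (hr i hi)]
    exact mem_of_mem_nhds (ht i)
  choose ρ hρ using hloc
  have hopen (x : X) : IsOpen {y : X | ∀ i ∈ Finset.Icc (-(ρ x : ℤ)) (ρ x), x.1 i = y.1 i} := by
    simp only [Set.ofPred_forall]
    exact isOpen_biInter_finset fun i _ => (isOpen_discrete {a | x.1 i = a}).preimage
      ((continuous_apply i).comp continuous_subtype_val)
  obtain ⟨t, ht⟩ := CompactSpace.elim_nhds_subcover _ fun x =>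
    (hopen x).mem_nhds fun i _ => rfl
  refine ⟨t.sup ρ, fun x y hxy => ?_⟩
  obtain ⟨z, hz, hzx⟩ : ∃ z ∈ t, ∀ i ∈ Finset.Icc (-(ρ z : ℤ)) (ρ z), z.1 i = x.1 i := by
    have : x ∈ (⊤ : Set X) := trivial
    rw [← ht] at this
    simpa using this
  have hzx' (i : ℤ) (hi : |i| ≤ ρ z) : z.1 i = x.1 i := hzx i (Finset.mem_Icc.mpr (abs_le.mp hi))
  have hle : (ρ z : ℤ) ≤ (t.sup ρ : ℕ) := by exact_mod_cast Finset.le_sup hz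
  have h1 := hρ z x hzx'
  have h2 := hρ z y fun i hi => (hzx' i hi).trans (hxy i (hi.trans hle))
  rw [abs_sub_comm] at h1
  linarith [abs_sub_le (φ x) (φ z) (φ y)]

variable [CompactSpace A]

theorem compOp_zpow_apply_orbitPoint (u : ℤ → A) (n : ℤ) (φ : C(orbitClosure u, ℝ)) (k : ℤ) :
    (compOp (subshift u) ^ n) φ (orbitPoint u k) = φ (orbitPoint u (k + n)) := by
  induction n generalizing k with
  | zero =>
    rw [zpow_zero, add_zero]
    rfl
  | succ n ih =>
    rw [add_comm (n : ℤ), zpow_one_add]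
    change compOp (subshift u) ((compOp (subshift u) ^ (n : ℤ)) φ) _ = _
    rw [compOp_apply_orbitPoint, ih, add_assoc]
  | pred n ih =>
    have h := ih (k - 1)
    rw [show (-n : ℤ) = 1 + (-n - 1) by ring, zpow_one_add] at h
    change compOp (subshift u) ((compOp (subshift u) ^ (-n - 1 : ℤ)) φ) _ = _ at h
    rw [compOp_apply_orbitPoint, sub_add_cancel] at h
    rw [h]
    congr 2
    ring

theorem zpow_mem_cyclicSpan {E : Type*} [NormedAddCommGroup E] [NormedSpace ℝ E]
    (U : E ≃L[ℝ] E) (F : Set E) (n : ℤ) {x : E} (hx : x ∈ cyclicSpan U F) :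
    (U ^ n) x ∈ cyclicSpan U F := by
  induction hx using Submodule.span_induction with
  | mem x hx =>
    obtain ⟨k, y, hy, rfl⟩ := hx
    refine Submodule.subset_span ⟨n + k, y, hy, ?_⟩
    rw [zpow_add]
    rfl
  | zero => rw [map_zero]; exact Submodule.zero_mem _
  | add x y _ _ hx hy => rw [map_add]; exact Submodule.add_mem _ hx hy
  | smul a x _ hx => rw [map_smul]; exact Submodule.smul_mem _ a hx

/-- The sequences uniformly approximable, along the orbit of `u`, by elements of the cyclic
span of `f`. -/
def approximable (u : ℤ → A) (f : C(orbitClosure u, ℝ)) : Submodule ℝ (ℤ → ℝ) where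
  carrier := {s | ∀ ε > 0, ∃ φ ∈ cyclicSpan (compOp (subshift u)) {f},
    ∀ k, |φ (orbitPoint u k) - s k| ≤ ε}
  zero_mem' ε hε := ⟨0, Submodule.zero_mem _, fun k => by simpa using hε.le⟩
  add_mem' {s t} hs ht ε hε := by
    obtain ⟨φ, hφ, h1⟩ := hs (ε / 2) (by positivity)
    obtain ⟨ψ, hψ, h2⟩ := ht (ε / 2) (by positivity)
    refine ⟨φ + ψ, Submodule.add_mem _ hφ hψ, fun k => ?_⟩
    rw [ContinuousMap.add_apply, Pi.add_apply, add_sub_add_comm]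
    exact (abs_add_le _ _).trans (by linarith [h1 k, h2 k])
  smul_mem' a s hs ε hε := by
    obtain ⟨φ, hφ, h⟩ := hs (ε / (|a| + 1)) (by positivity)
    refine ⟨a • φ, Submodule.smul_mem _ a hφ, fun k => ?_⟩
    rw [ContinuousMap.smul_apply, Pi.smul_apply, ← smul_sub, smul_eq_mul, abs_mul]
    calc |a| * |φ (orbitPoint u k) - s k| ≤ (|a| + 1) * (ε / (|a| + 1)) := by
          gcongr
          · linarith
          · exact h k
      _ = ε := by field_simp

theorem isClosedInvariant_approximable (u : ℤ → A) (f : C(orbitClosure u, ℝ)) :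
    IsClosedInvariant (approximable u f) where
  shift s hs c ε hε := by
    obtain ⟨φ, hφ, h⟩ := hs ε hε
    refine ⟨_, zpow_mem_cyclicSpan _ _ c hφ, fun k => ?_⟩
    rw [compOp_zpow_apply_orbitPoint]
    exact h _
  lim s hs ε hε := by
    obtain ⟨t, ht, h1⟩ := hs (ε / 2) (by positivity)
    obtain ⟨φ, hφ, h2⟩ := ht (ε / 2) (by positivity)
    refine ⟨φ, hφ, fun k => (abs_sub_le _ (t k) _).trans ?_⟩
    linarith [h1 k, h2 k]

theorem mem_approximable_self (u : ℤ → A) (f : C(orbitClosure u, ℝ)) :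
    (fun k => f (orbitPoint u k)) ∈ approximable u f := fun ε hε =>
  ⟨f, Submodule.subset_span ⟨0, f, rfl, by rw [zpow_zero]; rfl⟩, fun k => by simpa using hε.le⟩

theorem isGenerating_of_forall_mem_approximable (u : ℤ → A) (f : C(orbitClosure u, ℝ))
    (h : ∀ φ : C(orbitClosure u, ℝ), (fun k => φ (orbitPoint u k)) ∈ approximable u f) :
    IsGenerating (compOp (subshift u)) {f} := by
  intro φ
  rw [Metric.mem_closure_iff]
  intro ε hε
  obtain ⟨ψ, hψ, hk⟩ := h φ (ε / 2) (by positivity)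
  refine ⟨ψ, hψ, lt_of_le_of_lt ?_ (half_lt_self hε)⟩
  rw [ContinuousMap.dist_le (by positivity)]
  intro x
  refine (dense_range_orbitPoint u).induction_on (p := fun x => dist (φ x) (ψ x) ≤ ε / 2) x
    (isClosed_le (by fun_prop) continuous_const) fun k => ?_
  rw [dist_comm]
  exact hk k

theorem operatorMultiplicity_eq_one {E : Type*} [NormedAddCommGroup E] [NormedSpace ℝ E]
    [Nontrivial E] (U : E ≃L[ℝ] E) (x : E) (hx : IsGenerating U {x}) :
    operatorMultiplicity U = 1 := by
  apply le_antisymm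
  · exact (iInf₂_le _ hx).trans (Set.encard_singleton x).le
  · refine le_iInf₂ fun F hF => ?_
    rw [Set.one_le_encard_iff_nonempty, Set.nonempty_iff_ne_empty]
    rintro rfl
    have h0 : cyclicSpan U (∅ : Set E) = ⊥ := by simp [cyclicSpan]
    rw [Set.mem_ofPred_eq, IsGenerating, h0, Submodule.bot_coe, dense_iff_closure_eq,
      closure_singleton] at hF
    obtain ⟨y, hy⟩ := exists_ne (0 : E)
    have hmem := Set.mem_univ y
    rw [← hF] at hmem
    exact hy hmem

end Reduction

/-! ### A cyclic function for the Thue–Morse subshift -/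

/-- The function `x ↦ χ(x₀) + χ(x₋₁) χ(x₀)`, where `χ = ±1` is the sign of a letter. -/
def thueMorseGenerator : C(orbitClosure biThueMorse, ℝ) where
  toFun x := sgn (x.1 0) + sgn (x.1 (-1)) * sgn (x.1 0)
  continuous_toFun := by
    have h (i : ℤ) : Continuous fun x : orbitClosure biThueMorse => sgn (x.1 i) :=
      (continuous_of_discreteTopology (f := sgn)).comp
        ((continuous_apply i).comp continuous_subtype_val)
    exact (h 0).add ((h (-1)).mul (h 0))

theorem thueMorseGenerator_orbitPoint :
    (fun k => thueMorseGenerator (orbitPoint biThueMorse k)) = tau + gee := by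
  funext k
  change sgn (biThueMorse (0 + k)) + sgn (biThueMorse (-1 + k)) * sgn (biThueMorse (0 + k)) = _
  rw [zero_add, neg_add_eq_sub]
  rfl

theorem isGenerating_thueMorseGenerator :
    IsGenerating (compOp (subshift biThueMorse)) {thueMorseGenerator} := by
  refine isGenerating_of_forall_mem_approximable _ _ fun φ => ?_
  have hA := isClosedInvariant_approximable biThueMorse thueMorseGenerator
  have hf := mem_approximable_self biThueMorse thueMorseGenerator
  rw [thueMorseGenerator_orbitPoint] at hf
  refine hA.lim _ fun ε hε => ?_
  obtain ⟨r, hr⟩ := exists_window _ φ hε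
  let pattern (k : ℤ) (i : Fin (2 * r + 1)) : ℝ := tau (k + (i : ℕ))
  -- `Function.invFun` picks one representative position per pattern, so `s` depends on the window
  -- exactly. The `+ r` evaluates `φ` at the window's centre, and the later translation by `-r`
  -- undoes it.
  let s (k : ℤ) : ℝ := φ (orbitPoint biThueMorse (Function.invFun pattern (pattern k) + r))
  have hs : s ∈ approximable biThueMorse thueMorseGenerator :=
    hA.mem_of_window hf (2 * r + 1) s fun k k' h => by
      have : pattern k = pattern k' := funext fun i => h i i.isLt
      simp only [s, this]
  refine ⟨_, hA.shift s hs (-r), fun k => hr _ _ fun i hi => sgn_injective ?_⟩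
  have hpat : pattern (Function.invFun pattern (pattern (k + -r))) = pattern (k + -r) :=
    Function.invFun_eq ⟨_, rfl⟩
  rw [abs_le] at hi
  have h := congrFun hpat ⟨(i + r).toNat, by omega⟩
  simp only [pattern] at h
  rw [Int.toNat_of_nonneg (by omega)] at h
  change tau _ = tau _
  convert h using 2 <;> ring

end TopMult

theorem mainTheorem3 :
    TopMult.IsTopologicallySimple (TopMult.subshift TopMult.biThueMorse) := by
  -- Nonemptiness makes `C(X, ℝ)` nontrivial, which excludes multiplicity `0`.
  have : Nonempty (TopMult.orbitClosure TopMult.biThueMorse) :=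
    ⟨TopMult.orbitPoint TopMult.biThueMorse 0⟩
  exact TopMult.operatorMultiplicity_eq_one _ _ TopMult.isGenerating_thueMorseGenerator
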